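/- Let $H$ be a real Hilbert space and let $C_1,\dots,C_m$ be nonempty closed convex subsets of $H$ whose intersection may be empty. Let $w_i\ge 0$ with $\sum_{i=1}^m w_i=1$. With $P_{C_i}$ the metric projection onto $C_i$, put $$P_w(x)=\sum_{i=1}^m w_iP_{C_i}(x),\qquad \mathrm{Prox}(x)=\tfrac12\sum_{i=1}^m w_i\|P_{C_i}(x)-x\|^2\qquad(x\in H).$$ Let $S\subseteq H$ be convex and compact with $C_i\subseteq S$ for all $i$ and $P_w(x)\in S$ for all $x\in S$. Let $f:D\to\mathbb R$ be a continuous convex function on a convex set $D$ with $S\subseteq D\subseteq H$ (the choice $D=S$ is allowed). Write $$\partial f(x)=\{v\in H: f(y)\ge f(x)+\langle v,y-x\rangle\text{ for all }y\in D\},$$ $$\mathrm{SOL}(f,\mathrm{Fix}(P_w))=\{x\in \mathrm{Fix}(P_w): f(x)\le f(y)\text{ for all }y\in\mathrm{Fix}(P_w)\},$$ and assume that every point of $\mathrm{SOL}(f,\mathrm{Fix}(P_w))$ is an interior point of $D$ (for instance, $D$ is a neighbourhood of $S$). For step sizes $\{\alpha_k\}_{k\ge0}\subset(0,1]$, a sequence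 $\{x^k\}_{k\ge 0}\subset S$ is generated by the Hybrid Simultaneous Projection Subgradient Method if for every $k\ge0$: when $0\in\partial f(x^k)$, $x^{k+1}=P_w(x^k)$; when $0\notin\partial f(x^k)$, there is some $s^k\in\partial f(x^k)$ with $x^{k+1}=P_w\bigl(x^k-\alpha_k\,s^k/\|s^k\|\bigr)$. Then $\mathrm{Fix}(P_w)$ is the set of minimizers of $\mathrm{Prox}$ over $H$, the set $\mathrm{SOL}(f,\mathrm{Fix}(P_w))$ is nonempty, and there is a real number $\bar L>1$ such that for every sequence $\{\alpha_k\}_{k\ge0}\subset(0,1]$ with $\lim_{k\to\infty}\alpha_k=0$ and $\sum_{k=0}^\infty\alpha_k=\infty$, and every $\tau\in(0,1)$, there is an integer $K\ge 0$ such that for every sequence $\{x^k\}_{k\ge0}\subset S$ generated by the method with the step sizes $\{\alpha_k\}$ and for all integers $k\ge K$, $$d\bigl(x^k,\mathrm{SOL}(f,\mathrm{Fix}(P_w))\bigr)\le\tau\quad\text{and}\quad f(x^k)\le f(z)+\tau\bar L\ \text{ for all } z\in\mathrm{SOL}(f,\mathrm{Fix}(P_w)).$$ -/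

import Mathlib

noncomputable section

namespace HSPSM

variable {H : Type*} [NormedAddCommGroup H] [InnerProductSpace ℝ H]

/-- The metric projection `P_A(x)`: the point of `A` nearest to `x`. It exists and is unique when
`A` is nonempty, closed and convex in a Hilbert space; see `metricProj_spec`
and `metricProj_unique`. -/
def metricProj (A : Set H) (x : H) : H :=
  Classical.epsilon fun p => p ∈ A ∧ ∀ y ∈ A, ‖x - p‖ ≤ ‖x - y‖

theorem metricProj_spec [CompleteSpace H] {A : Set H} (hne : A.Nonempty) (hcl : IsClosed A)
    (hcv : Convex ℝ A) (x : H) :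
    metricProj A x ∈ A ∧ ∀ y ∈ A, ‖x - metricProj A x‖ ≤ ‖x - y‖ := by
  have key : ∃ p, p ∈ A ∧ ∀ y ∈ A, ‖x - p‖ ≤ ‖x - y‖ := by
    obtain ⟨p, hp, h⟩ := exists_norm_eq_iInf_of_complete_convex hne hcl.isComplete hcv x
    refine ⟨p, hp, fun y hy => ?_⟩
    rw [h]
    exact ciInf_le (f := fun w : A => ‖x - w‖)
      ⟨0, by rintro _ ⟨w, rfl⟩; exact norm_nonneg _⟩ ⟨y, hy⟩
  exact Classical.epsilon_spec key

theorem metricProj_unique [CompleteSpace H] {A : Set H} (hcl : IsClosed A)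
    (hcv : Convex ℝ A) {x p : H} (hp : p ∈ A) (hmin : ∀ y ∈ A, ‖x - p‖ ≤ ‖x - y‖) :
    p = metricProj A x := by
  have hne : A.Nonempty := ⟨p, hp⟩
  obtain ⟨hq, hqmin⟩ := metricProj_spec hne hcl hcv x
  have var : ∀ v ∈ A, (∀ y ∈ A, ‖x - v‖ ≤ ‖x - y‖) → ∀ y ∈ A, inner ℝ (x - v) (y - v) ≤ 0 := by
    intro v hv hvmin
    refine (norm_eq_iInf_iff_real_inner_le_zero hcv hv).1 (le_antisymm ?_ ?_)
    · have : Nonempty A := ⟨⟨v, hv⟩⟩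
      exact le_ciInf fun w => hvmin w w.2
    · exact ciInf_le (f := fun w : A => ‖x - w‖)
        ⟨0, by rintro _ ⟨w, rfl⟩; exact norm_nonneg _⟩ ⟨v, hv⟩
  have h1 := var p hp hmin _ hq
  have h2 := var _ hq hqmin _ hp
  set q := metricProj A x
  have h3 : inner ℝ (p - q) (p - q) ≤ (0 : ℝ) := by
    have e1 : inner ℝ (x - p) (q - p) = -(inner ℝ (x - p) (p - q) : ℝ) := by
      rw [← neg_sub p q, inner_neg_right]
    have e2 : inner ℝ (p - q) (p - q) =
        (inner ℝ (x - q) (p - q) : ℝ) - inner ℝ (x - p) (p - q) := by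
      rw [← inner_sub_left]; congr 1; abel
    linarith
  rw [real_inner_self_eq_norm_sq] at h3
  have h4 : ‖p - q‖ = 0 := by nlinarith [norm_nonneg (p - q), sq_nonneg ‖p - q‖]
  exact sub_eq_zero.1 (norm_eq_zero.1 h4)

/-- The simultaneous projection operator `P_w(x) = ∑ i, w i • P_{C i}(x)`. -/
def simProj {m : ℕ} (C : Fin m → Set H) (w : Fin m → ℝ) (x : H) : H :=
  ∑ i, w i • metricProj (C i) x

/-- The proximity function `Prox(x) = ½ ∑ i, w i ‖P_{C i}(x) - x‖²`. -/
def prox {m : ℕ} (C : Fin m → Set H) (w : Fin m → ℝ) (x : H) : ℝ :=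
  1 / 2 * ∑ i, w i * ‖metricProj (C i) x - x‖ ^ 2

/-- `SOL(f, F)`: the minimizers of `f` over `F`. -/
def SOL (f : H → ℝ) (F : Set H) : Set H :=
  {x | x ∈ F ∧ ∀ y ∈ F, f x ≤ f y}

/-- The subgradient set `∂f(x)` of a function whose domain is `D` (values of `f` off `D` play
no role). -/
def subgrad (D : Set H) (f : H → ℝ) (x : H) : Set H :=
  {v | ∀ y ∈ D, f x + inner ℝ v (y - x) ≤ f y}

/-- The sequence `x` is generated, with the step sizes `α`, by the hybrid simultaneous projection
subgradient method for the target function `f` with domain `D`. The choices of subgradients are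
recorded in the sequence `s`. -/
def IsGenerated {m : ℕ} (D : Set H) (f : H → ℝ) (C : Fin m → Set H) (w : Fin m → ℝ)
    (α : ℕ → ℝ) (x : ℕ → H) : Prop :=
  ∃ s : ℕ → H, ∀ k,
    (0 ∈ subgrad D f (x k) → s k = 0 ∧ x (k + 1) = simProj C w (x k)) ∧
    (0 ∉ subgrad D f (x k) → s k ∈ subgrad D f (x k) ∧
      x (k + 1) = simProj C w (x k - (α k / ‖s k‖) • s k))

end HSPSM

end

/-!
The operator `P_w` is a convex combination of metric projections, hence firmly nonexpansive
(`norm_sq_simProj_sub_le`). The weighted variance identity `sum_norm_sq_eq` and the subgradient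
inequality for squared distances identify its fixed points with the minimizers of `Prox`
(`fixedPoints_eq_argmin_prox`), and since `P_w` maps everything into the compact set `S` without
increasing `Prox`, a minimizer exists. So `SOL` is a nonempty compact set in the interior of `D`.

Write `d k` for the distance of the `k`-th iterate to `SOL`. Steps have length at most `α k` and
`P_w` is nonexpansive, so `d (k + 1) ≤ d k + α k`. The heart of the matter is `descent`: while
`d k ≥ δ` and `α k` is small, `d (k + 1) ^ 2 ≤ d k ^ 2 - r * α k` for a constant `r > 0`. Indeed, by
compactness of `S`, a point at distance at least `δ` from `SOL` either has a value of `f` exceeding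
the optimal one by a fixed amount, or is moved by `P_w` by a fixed amount. In the first case a whole
ball of fixed radius around each point of `SOL` lies in a strict sublevel set (here `SOL` being
interior to `D` enters), so the normalized subgradient makes a definite angle with the direction
towards `SOL`. In the second, firm nonexpansiveness yields a definite decrease, which dominates the
perturbation. Since `∑ α k` diverges, `d` reaches `2 * δ` at a time depending on `α` only, and
as `α k` is small it never exceeds `2 * δ` afterwards (`exists_forall_le_of_descent`).

The bound on the values of `f` follows from the bound on the distances, as a convex function bounded
on a ball around a point grows at most linearly there (`le_add_infDist_div`).
-/

namespace HSPSM

variable {H : Type*} [NormedAddCommGroup H] [InnerProductSpace ℝ H]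

/-! ### Metric projections and their averages -/

theorem inner_sub_metricProj_le [CompleteSpace H] {A : Set H} (hne : A.Nonempty)
    (hcl : IsClosed A) (hcv : Convex ℝ A) (x : H) {y : H} (hy : y ∈ A) :
    inner ℝ (x - metricProj A x) (y - metricProj A x) ≤ 0 := by
  obtain ⟨hp, hmin⟩ := metricProj_spec hne hcl hcv x
  refine (norm_eq_iInf_iff_real_inner_le_zero hcv hp).1 (le_antisymm ?_ ?_) y hy
  · have : Nonempty A := ⟨⟨_, hp⟩⟩
    exact le_ciInf fun w => hmin w w.2
  · exact ciInf_le (f := fun w : A => ‖x - w‖)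
      ⟨0, by rintro _ ⟨w, rfl⟩; exact norm_nonneg _⟩ ⟨_, hp⟩

/-- Metric projections are firmly nonexpansive. -/
theorem norm_sq_metricProj_sub_le [CompleteSpace H] {A : Set H} (hne : A.Nonempty)
    (hcl : IsClosed A) (hcv : Convex ℝ A) (x y : H) :
    ‖metricProj A x - metricProj A y‖ ^ 2 ≤ inner ℝ (metricProj A x - metricProj A y) (x - y) := by
  have h1 := inner_sub_metricProj_le hne hcl hcv x (metricProj_spec hne hcl hcv y).1
  have h2 := inner_sub_metricProj_le hne hcl hcv y (metricProj_spec hne hcl hcv x).1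
  set p := metricProj A x
  set q := metricProj A y
  have e : inner ℝ (p - q) (x - y) - ‖p - q‖ ^ 2 =
      -(inner ℝ (x - p) (q - p) + inner ℝ (y - q) (p - q)) := by
    rw [← real_inner_self_eq_norm_sq, ← inner_sub_right, ← neg_sub p q, inner_neg_right,
      real_inner_comm, neg_add_eq_sub, ← inner_sub_left, ← inner_neg_left]
    congr 1
    abel
  linarith

/-- The subgradient inequality for half the squared distance to `A`, whose gradient at `x` is
`x - metricProj A x`. -/
theorem norm_sq_metricProj_sub_ge [CompleteSpace H] {A : Set H} (hne : A.Nonempty)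
    (hcl : IsClosed A) (hcv : Convex ℝ A) (x y : H) :
    ‖metricProj A x - x‖ ^ 2 + 2 * inner ℝ (x - metricProj A x) (y - x) ≤
      ‖metricProj A y - y‖ ^ 2 := by
  have h := inner_sub_metricProj_le hne hcl hcv x (metricProj_spec hne hcl hcv y).1
  set p := metricProj A x
  set q := metricProj A y
  have e : y - q = (x - p) + ((y - x) - (q - p)) := by abel
  rw [norm_sub_rev p x, norm_sub_rev q y, e, norm_add_sq_real, inner_sub_right _ (y - x)]
  nlinarith [sq_nonneg ‖(y - x) - (q - p)‖]

theorem continuous_metricProj [CompleteSpace H] {A : Set H} (hne : A.Nonempty)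
    (hcl : IsClosed A) (hcv : Convex ℝ A) : Continuous (metricProj A) := by
  refine (LipschitzWith.of_dist_le' (K := 1) fun x y => ?_).continuous
  rw [dist_eq_norm, dist_eq_norm, one_mul]
  have h1 := norm_sq_metricProj_sub_le hne hcl hcv x y
  have h2 := real_inner_le_norm (metricProj A x - metricProj A y) (x - y)
  by_contra! h
  nlinarith [norm_nonneg (x - y)]

/-- The variance identity for the weights `w`. -/
theorem sum_norm_sq_eq {ι : Type*} [Fintype ι] {w : ι → ℝ} (hw : ∑ i, w i = 1) (v : ι → H) :
    ∑ i, w i * ‖v i‖ ^ 2 =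
      ∑ i, w i * ‖v i - ∑ j, w j • v j‖ ^ 2 + ‖∑ j, w j • v j‖ ^ 2 := by
  set c := ∑ j, w j • v j with hc
  have e : ∑ i, w i * inner ℝ (v i) c = ‖c‖ ^ 2 := by
    rw [← real_inner_self_eq_norm_sq]
    conv_rhs => rw [hc, sum_inner]
    simp only [real_inner_smul_left, hc]
  have e2 : ∀ i, w i * ‖v i - c‖ ^ 2 =
      w i * ‖v i‖ ^ 2 - 2 * (w i * inner ℝ (v i) c) + w i * ‖c‖ ^ 2 := fun i => by
    rw [norm_sub_sq_real]
    ring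
  simp only [e2, Finset.sum_add_distrib, Finset.sum_sub_distrib, ← Finset.mul_sum,
    ← Finset.sum_mul, hw, e]
  ring

section Averages

variable [CompleteSpace H] {m : ℕ} {C : Fin m → Set H} {w : Fin m → ℝ}
  (hne : ∀ i, (C i).Nonempty) (hcl : ∀ i, IsClosed (C i)) (hcv : ∀ i, Convex ℝ (C i))
  (hw0 : ∀ i, 0 ≤ w i) (hw1 : ∑ i, w i = 1)

include hne hcl hcv

theorem continuous_simProj : Continuous (simProj C w) :=
  continuous_finsetSum _ fun i _ =>
    (continuous_metricProj (hne i) (hcl i) (hcv i)).const_smul (w i)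

theorem continuous_prox : Continuous (prox C w) := by
  have h := fun i => continuous_metricProj (hne i) (hcl i) (hcv i)
  unfold prox
  fun_prop

include hw0 hw1

theorem simProj_mem {S : Set H} (hS : Convex ℝ S) (hCS : ∀ i, C i ⊆ S) (x : H) :
    simProj C w x ∈ S :=
  hS.sum_mem (fun i _ => hw0 i) hw1 fun i _ =>
    hCS i (metricProj_spec (hne i) (hcl i) (hcv i) x).1

/-- `P_w` is firmly nonexpansive. -/
theorem norm_sq_simProj_sub_le (x y : H) :
    ‖simProj C w x - simProj C w y‖ ^ 2 ≤ inner ℝ (simProj C w x - simProj C w y) (x - y) := by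
  have e : simProj C w x - simProj C w y =
      ∑ i, w i • (metricProj (C i) x - metricProj (C i) y) := by
    simp only [simProj, smul_sub, Finset.sum_sub_distrib]
  have h := sum_norm_sq_eq hw1 fun i => metricProj (C i) x - metricProj (C i) y
  have h0 : 0 ≤ ∑ i, w i * ‖metricProj (C i) x - metricProj (C i) y -
      ∑ j, w j • (metricProj (C j) x - metricProj (C j) y)‖ ^ 2 :=
    Finset.sum_nonneg fun i _ => mul_nonneg (hw0 i) (sq_nonneg _)
  have h1 : ∑ i, w i * ‖metricProj (C i) x - metricProj (C i) y‖ ^ 2 ≤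
      ∑ i, w i * inner ℝ (metricProj (C i) x - metricProj (C i) y) (x - y) :=
    Finset.sum_le_sum fun i _ => mul_le_mul_of_nonneg_left
      (norm_sq_metricProj_sub_le (hne i) (hcl i) (hcv i) x y) (hw0 i)
  rw [e, sum_inner]
  simp only [real_inner_smul_left]
  linarith

theorem norm_simProj_sub_le (x y : H) : ‖simProj C w x - simProj C w y‖ ≤ ‖x - y‖ := by
  have h1 := norm_sq_simProj_sub_le hne hcl hcv hw0 hw1 x y
  have h2 := real_inner_le_norm (simProj C w x - simProj C w y) (x - y)
  by_contra! h
  nlinarith [norm_nonneg (x - y)]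

theorem norm_sq_simProj_sub_fixed_le (x : H) {z : H}
    (hz : z ∈ Function.fixedPoints (simProj C w)) :
    ‖simProj C w x - z‖ ^ 2 ≤ ‖x - z‖ ^ 2 - ‖simProj C w x - x‖ ^ 2 := by
  have h := norm_sq_simProj_sub_le hne hcl hcv hw0 hw1 x z
  rw [show simProj C w z = z from hz] at h
  have e : simProj C w x - x = (simProj C w x - z) - (x - z) := by abel
  rw [e, norm_sub_sq_real (simProj C w x - z)]
  linarith

theorem prox_simProj_le (x : H) :
    prox C w (simProj C w x) ≤ prox C w x - 1 / 2 * ‖simProj C w x - x‖ ^ 2 := by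
  have h := sum_norm_sq_eq hw1 fun i => metricProj (C i) x - x
  have e : ∑ i, w i • (metricProj (C i) x - x) = simProj C w x - x := by
    simp only [smul_sub, Finset.sum_sub_distrib, ← Finset.sum_smul, hw1, one_smul, simProj]
  simp only [e, sub_sub_sub_cancel_right] at h
  have h1 : ∑ i, w i * ‖metricProj (C i) (simProj C w x) - simProj C w x‖ ^ 2 ≤
      ∑ i, w i * ‖metricProj (C i) x - simProj C w x‖ ^ 2 := by
    refine Finset.sum_le_sum fun i _ => mul_le_mul_of_nonneg_left ?_ (hw0 i)
    rw [norm_sub_rev, norm_sub_rev _ (simProj C w x)]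
    exact pow_le_pow_left₀ (norm_nonneg _)
      ((metricProj_spec (hne i) (hcl i) (hcv i) _).2 _
        (metricProj_spec (hne i) (hcl i) (hcv i) x).1) 2
  unfold prox
  linarith

theorem fixedPoints_eq_argmin_prox :
    Function.fixedPoints (simProj C w) = {x | ∀ y, prox C w x ≤ prox C w y} := by
  ext x
  constructor
  · intro hx y
    have h : ∑ i, w i * (‖metricProj (C i) x - x‖ ^ 2 +
          2 * inner ℝ (x - metricProj (C i) x) (y - x)) ≤
        ∑ i, w i * ‖metricProj (C i) y - y‖ ^ 2 :=
      Finset.sum_le_sum fun i _ => mul_le_mul_of_nonneg_left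
        (norm_sq_metricProj_sub_ge (hne i) (hcl i) (hcv i) x y) (hw0 i)
    have e : ∑ i, w i * inner ℝ (x - metricProj (C i) x) (y - x) = 0 := by
      simp only [← real_inner_smul_left]
      rw [← sum_inner]
      simp only [smul_sub, Finset.sum_sub_distrib, ← Finset.sum_smul, hw1, one_smul]
      rw [show ∑ i, w i • metricProj (C i) x = x from hx, sub_self, inner_zero_left]
    simp only [mul_add, Finset.sum_add_distrib, mul_left_comm _ (2 : ℝ), ← Finset.mul_sum,
      e] at h
    unfold prox
    linarith
  · intro hx
    have h := prox_simProj_le hne hcl hcv hw0 hw1 x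
    have h1 := hx (simProj C w x)
    have h2 : ‖simProj C w x - x‖ = 0 := by nlinarith [norm_nonneg (simProj C w x - x)]
    exact sub_eq_zero.1 (norm_eq_zero.1 h2)

theorem fixedPoints_nonempty {S : Set H} (hS : Convex ℝ S) (hSc : IsCompact S)
    (hCS : ∀ i, C i ⊆ S) : (Function.fixedPoints (simProj C w)).Nonempty := by
  have hmem := simProj_mem hne hcl hcv hw0 hw1 hS hCS
  obtain ⟨x, -, hx⟩ := hSc.exists_isMinOn ⟨_, hmem 0⟩
    (continuous_prox (w := w) hne hcl hcv).continuousOn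
  refine ⟨x, ?_⟩
  rw [fixedPoints_eq_argmin_prox hne hcl hcv hw0 hw1]
  intro y
  have h1 : prox C w x ≤ prox C w (simProj C w y) := hx (hmem y)
  have h2 := prox_simProj_le hne hcl hcv hw0 hw1 y
  nlinarith [sq_nonneg ‖simProj C w y - y‖]

theorem isCompact_fixedPoints {S : Set H} (hS : Convex ℝ S) (hSc : IsCompact S)
    (hCS : ∀ i, C i ⊆ S) : IsCompact (Function.fixedPoints (simProj C w)) := by
  refine hSc.of_isClosed_subset
    (isClosed_eq (continuous_simProj hne hcl hcv) continuous_id) fun x hx => ?_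
  rw [← show simProj C w x = x from hx]
  exact simProj_mem hne hcl hcv hw0 hw1 hS hCS x

end Averages

/-! ### The solution set -/

theorem SOL_nonempty {X : Type*} [TopologicalSpace X] {f : X → ℝ} {F : Set X} (hF : IsCompact F)
    (hne : F.Nonempty) (hf : ContinuousOn f F) : (SOL f F).Nonempty := by
  obtain ⟨z, hz, hmin⟩ := hF.exists_isMinOn hne hf
  exact ⟨z, hz, fun y hy => hmin hy⟩

theorem isCompact_SOL {X : Type*} [TopologicalSpace X] [T2Space X] {f : X → ℝ} {F : Set X}
    (hF : IsCompact F) (hf : ContinuousOn f F) :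
    IsCompact (SOL f F) := by
  rcases (SOL f F).eq_empty_or_nonempty with h | ⟨z, hz⟩
  · rw [h]
    exact isCompact_empty
  · have e : SOL f F = F ∩ f ⁻¹' Set.Iic (f z) := by
      ext x
      exact ⟨fun hx => ⟨hx.1, hx.2 z hz.1⟩, fun hx => ⟨hx.1, fun y hy => hx.2.trans (hz.2 y hy)⟩⟩
    rw [e]
    exact hF.of_isClosed_subset (hf.preimage_isClosed_of_isClosed hF.isClosed isClosed_Iic)
      Set.inter_subset_left

theorem eq_of_mem_SOL {X : Type*} {f : X → ℝ} {F : Set X} {y z : X} (hy : y ∈ SOL f F)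
    (hz : z ∈ SOL f F) : f y = f z :=
  le_antisymm (hy.2 z hz.1) (hz.2 y hy.1)

/-- Around all solutions, `f` is nearly optimal on balls of one and the same radius. -/
theorem exists_radius_SOL {E : Type*} [NormedAddCommGroup E] {f : E → ℝ} {F D : Set E}
    (hf : ContinuousOn f D) (hK : IsCompact (SOL f F)) (hint : SOL f F ⊆ interior D)
    {ε : ℝ} (hε : 0 < ε) :
    ∃ r > 0, ∀ z ∈ SOL f F, ∀ y, ‖y - z‖ ≤ r → y ∈ D ∧ f y < f z + ε := by
  rcases (SOL f F).eq_empty_or_nonempty with h | ⟨z₀, hz₀⟩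
  · exact ⟨1, one_pos, fun z hz => by simp [h] at hz⟩
  have hU : IsOpen (interior D ∩ f ⁻¹' Set.Iio (f z₀ + ε)) :=
    (hf.mono interior_subset).isOpen_inter_preimage isOpen_interior isOpen_Iio
  have hsub : SOL f F ⊆ interior D ∩ f ⁻¹' Set.Iio (f z₀ + ε) := fun z hz =>
    ⟨hint hz, by
      rw [Set.mem_preimage, Set.mem_Iio, eq_of_mem_SOL hz hz₀]
      linarith⟩
  obtain ⟨r, hr, hball⟩ := hK.exists_cthickening_subset_open hU hsub
  refine ⟨r, hr, fun z hz y hy => ?_⟩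
  have h := hball (Metric.mem_cthickening_of_dist_le y z r _ hz (by rwa [dist_eq_norm]))
  exact ⟨interior_subset h.1, by rw [eq_of_mem_SOL hz hz₀]; exact h.2⟩

/-- A convex function that exceeds its value at `z` by at most one on a ball of radius `r` grows
with slope at most `1 / r` there. -/
theorem le_add_norm_div {f : H → ℝ} {D : Set H} (hf : ConvexOn ℝ D f) {z : H} {r : ℝ} (hr : 0 < r)
    (hball : ∀ y, ‖y - z‖ ≤ r → y ∈ D ∧ f y ≤ f z + 1) {x : H} (hx : ‖x - z‖ ≤ r) :
    f x ≤ f z + ‖x - z‖ / r := by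
  rcases eq_or_ne x z with rfl | hne
  · simp
  have ht : 0 < ‖x - z‖ := norm_pos_iff.2 (sub_ne_zero.2 hne)
  set t := ‖x - z‖ with ht_def
  -- `x` lies between `z` and the point `y` of the sphere of radius `r` in the same direction.
  set y := z + (r / t) • (x - z) with hy_def
  have hy : ‖y - z‖ ≤ r := by
    rw [hy_def, add_sub_cancel_left, norm_smul, Real.norm_of_nonneg (by positivity), ← ht_def,
      div_mul_cancel₀ _ ht.ne']
  have hz : z ∈ D := (hball z (by simpa using hr.le)).1
  have hconv := hf.2 hz (hball y hy).1 (sub_nonneg.2 ((div_le_one hr).2 hx))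
    (show 0 ≤ t / r by positivity) (by ring)
  have e : (1 - t / r) • z + (t / r) • y = x := by
    rw [hy_def, smul_add, smul_smul, show t / r * (r / t) = 1 by field_simp, one_smul, sub_smul,
      one_smul]
    abel
  rw [e, smul_eq_mul, smul_eq_mul] at hconv
  have := mul_le_mul_of_nonneg_left (hball y hy).2 (show 0 ≤ t / r by positivity)
  linarith

theorem le_add_infDist_div {f : H → ℝ} {F D : Set H} (hf : ConvexOn ℝ D f)
    (hK : IsCompact (SOL f F)) {r : ℝ} (hr : 0 < r)
    (hball : ∀ z ∈ SOL f F, ∀ y, ‖y - z‖ ≤ r → y ∈ D ∧ f y < f z + 1) {x z : H}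
    (hz : z ∈ SOL f F) (hx : Metric.infDist x (SOL f F) ≤ r) :
    f x ≤ f z + Metric.infDist x (SOL f F) / r := by
  obtain ⟨p, hp, e⟩ := hK.exists_infDist_eq_dist ⟨z, hz⟩ x
  rw [dist_eq_norm] at e
  rw [e] at hx ⊢
  rw [eq_of_mem_SOL hz hp]
  exact le_add_norm_div hf hr (fun y hy => ⟨(hball p hp y hy).1, (hball p hp y hy).2.le⟩) hx

/-! ### One step of the method -/

/-- A subgradient at `x` makes a definite angle with the direction from any ball centre `z` to `x`,
if the ball lies in the sublevel set of `x`. -/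
theorem le_inner_of_subgrad {f : H → ℝ} {D : Set H} {x z s : H} (hs : s ∈ subgrad D f x)
    (hs0 : s ≠ 0) {r : ℝ} (hr : 0 ≤ r) (hball : ∀ y, ‖y - z‖ ≤ r → y ∈ D ∧ f y ≤ f x) :
    r * ‖s‖ ≤ inner ℝ s (x - z) := by
  have hn : 0 < ‖s‖ := norm_pos_iff.2 hs0
  have hy := hball (z + (r / ‖s‖) • s) (by
    rw [add_sub_cancel_left, norm_smul, Real.norm_of_nonneg (by positivity),
      div_mul_cancel₀ _ hn.ne'])
  have h := hs _ hy.1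
  have e : inner ℝ s (z + (r / ‖s‖) • s - x) = r * ‖s‖ - inner ℝ s (x - z) := by
    rw [show z + (r / ‖s‖) • s - x = (r / ‖s‖) • s - (x - z) by abel, inner_sub_right,
      real_inner_smul_right, real_inner_self_eq_norm_sq]
    congr 1
    field_simp
  rw [e] at h
  linarith [hy.2]

theorem norm_normalized_smul {a : ℝ} (ha : 0 ≤ a) {s : H} (hs : s ≠ 0) :
    ‖(a / ‖s‖) • s‖ = a := by
  have hn : 0 < ‖s‖ := norm_pos_iff.2 hs
  rw [norm_smul, Real.norm_of_nonneg (by positivity), div_mul_cancel₀ _ hn.ne']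

/-- `x'` arises from `x` by one step of the method with step size `a`. The point `y` to which
`P_w` is applied is `x` itself if `x` minimizes `f` over `D`; otherwise it is `x` moved by `a`
against a subgradient. -/
def IsStep {m : ℕ} (D : Set H) (f : H → ℝ) (C : Fin m → Set H) (w : Fin m → ℝ)
    (a : ℝ) (x x' : H) : Prop :=
  ∃ y, x' = simProj C w y ∧ ((y = x ∧ ∀ u ∈ D, f x ≤ f u) ∨
    ∃ s, s ≠ 0 ∧ s ∈ subgrad D f x ∧ y = x - (a / ‖s‖) • s)

theorem IsGenerated.isStep {m : ℕ} {D : Set H} {f : H → ℝ} {C : Fin m → Set H} {w : Fin m → ℝ}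
    {α : ℕ → ℝ} {x : ℕ → H} (h : IsGenerated D f C w α x) (k : ℕ) :
    IsStep D f C w (α k) (x k) (x (k + 1)) := by
  obtain ⟨s, hs⟩ := h
  by_cases h0 : 0 ∈ subgrad D f (x k)
  · exact ⟨x k, ((hs k).1 h0).2, Or.inl ⟨rfl, fun u hu => by simpa using h0 u hu⟩⟩
  · obtain ⟨h1, h2⟩ := (hs k).2 h0
    exact ⟨_, h2, Or.inr ⟨s k, fun e => h0 (e ▸ h1), h1, rfl⟩⟩

section Step

variable [CompleteSpace H] {m : ℕ} {C : Fin m → Set H} {w : Fin m → ℝ}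
  (hne : ∀ i, (C i).Nonempty) (hcl : ∀ i, IsClosed (C i)) (hcv : ∀ i, Convex ℝ (C i))
  (hw0 : ∀ i, 0 ≤ w i) (hw1 : ∑ i, w i = 1)

include hne hcl hcv

/-- Away from `SOL`, a point has a value well above the optimum or is moved well by `P_w`. -/
theorem exists_gap {S : Set H} {f : H → ℝ} (hSc : IsCompact S) (hf : ContinuousOn f S) {z : H}
    (hz : z ∈ SOL f (Function.fixedPoints (simProj C w))) {δ : ℝ} (hδ : 0 < δ) :
    ∃ ε > 0, ∀ x ∈ S, δ ≤ Metric.infDist x (SOL f (Function.fixedPoints (simProj C w))) →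
      f z + ε ≤ f x ∨ ε ≤ ‖simProj C w x - x‖ := by
  set K := SOL f (Function.fixedPoints (simProj C w)) with hK
  have hT : IsCompact (S ∩ {x | δ ≤ Metric.infDist x K}) :=
    hSc.inter_right (isClosed_le continuous_const (Metric.continuous_infDist_pt K))
  have hg : ContinuousOn (fun x => max (f x - f z) ‖simProj C w x - x‖)
      (S ∩ {x | δ ≤ Metric.infDist x K}) :=
    ContinuousOn.sup ((hf.mono Set.inter_subset_left).sub continuousOn_const)
      ((continuous_simProj hne hcl hcv).sub continuous_id).norm.continuousOn
  rcases (S ∩ {x | δ ≤ Metric.infDist x K}).eq_empty_or_nonempty with h | h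
  · exact ⟨1, one_pos, fun x hx hd => absurd (show x ∈ S ∩ {x | δ ≤ Metric.infDist x K} from
      ⟨hx, hd⟩) (by simp [h])⟩
  obtain ⟨p, hp, hmin⟩ := hT.exists_isMinOn h hg
  refine ⟨max (f p - f z) ‖simProj C w p - p‖, ?_, fun x hx hd => ?_⟩
  · by_contra! hle
    have h1 : f p ≤ f z := sub_nonpos.1 ((le_max_left _ _).trans hle)
    have h2 : simProj C w p = p :=
      sub_eq_zero.1 (norm_le_zero_iff.1 ((le_max_right _ _).trans hle))
    have h3 : p ∈ K := ⟨h2, fun y hy => h1.trans (hz.2 y hy)⟩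
    have h4 : δ ≤ Metric.infDist p K := hp.2
    rw [Metric.infDist_zero_of_mem h3] at h4
    linarith
  · have h1 : max (f p - f z) ‖simProj C w p - p‖ ≤ max (f x - f z) ‖simProj C w x - x‖ :=
      hmin (show x ∈ S ∩ {x | δ ≤ Metric.infDist x K} from ⟨hx, hd⟩)
    rcases le_max_iff.1 h1 with h1 | h1
    · exact Or.inl (by linarith)
    · exact Or.inr h1

include hw0 hw1

theorem IsStep.norm_sub_le {D : Set H} {f : H → ℝ} {a : ℝ} {x x' : H}
    (h : IsStep D f C w a x x') (ha : 0 ≤ a) {z : H}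
    (hz : z ∈ Function.fixedPoints (simProj C w)) : ‖x' - z‖ ≤ ‖x - z‖ + a := by
  obtain ⟨y, rfl, hy⟩ := h
  have h1 := norm_simProj_sub_le hne hcl hcv hw0 hw1 y z
  rw [show simProj C w z = z from hz] at h1
  refine h1.trans ?_
  rcases hy with ⟨rfl, -⟩ | ⟨s, hs, -, rfl⟩
  · linarith
  · rw [show x - (a / ‖s‖) • s - z = (x - z) - (a / ‖s‖) • s by abel]
    exact (_root_.norm_sub_le _ _).trans_eq (by rw [norm_normalized_smul ha hs])

/-- The step away from a point of high value decreases the distance to every solution. -/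
theorem IsStep.norm_sq_sub_le_of_ball {D : Set H} {f : H → ℝ} {a r : ℝ} {x x' : H}
    (h : IsStep D f C w a x x') (ha : 0 ≤ a) (hr : 0 ≤ r) (har : a ≤ r) {z : H}
    (hz : z ∈ Function.fixedPoints (simProj C w))
    (hball : ∀ y, ‖y - z‖ ≤ r → y ∈ D ∧ f y < f x) :
    ‖x' - z‖ ^ 2 ≤ ‖x - z‖ ^ 2 - r * a := by
  obtain ⟨y, rfl, hy⟩ := h
  have h1 := norm_simProj_sub_le hne hcl hcv hw0 hw1 y z
  rw [show simProj C w z = z from hz] at h1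
  refine (pow_le_pow_left₀ (norm_nonneg _) h1 2).trans ?_
  rcases hy with ⟨rfl, hmin⟩ | ⟨s, hs, hsub, rfl⟩
  · have := hball z (by simpa using hr)
    exact absurd (hmin z this.1) (not_le.2 this.2)
  · have hn : 0 < ‖s‖ := norm_pos_iff.2 hs
    have hin := le_inner_of_subgrad hsub hs hr fun y hy => ⟨(hball y hy).1, (hball y hy).2.le⟩
    have e : r * a ≤ inner ℝ (x - z) ((a / ‖s‖) • s) := by
      rw [real_inner_smul_right, real_inner_comm]
      calc r * a = a / ‖s‖ * (r * ‖s‖) := by field_simp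
        _ ≤ _ := mul_le_mul_of_nonneg_left hin (by positivity)
    rw [show x - (a / ‖s‖) • s - z = (x - z) - (a / ‖s‖) • s by abel, norm_sub_sq_real,
      norm_normalized_smul ha hs]
    nlinarith

/-- The step from a point that `P_w` moves by at least `η` decreases the distance to every fixed
point, if the step size is small. -/
theorem IsStep.norm_sq_sub_le_of_move {D : Set H} {f : H → ℝ} {a η M : ℝ} {x x' : H}
    (h : IsStep D f C w a x x') (ha : 0 ≤ a) (haη : 4 * a ≤ η) {z : H}
    (hz : z ∈ Function.fixedPoints (simProj C w)) (hM : ‖x - z‖ ≤ M)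
    (hη : η ≤ ‖simProj C w x - x‖) :
    ‖x' - z‖ ^ 2 ≤ ‖x - z‖ ^ 2 + (2 * M + a) * a - η ^ 2 / 4 := by
  obtain ⟨y, rfl, hy⟩ := h
  have hyx : ‖y - x‖ ≤ a := by
    rcases hy with ⟨rfl, -⟩ | ⟨s, hs, -, rfl⟩
    · simpa using ha
    · rw [sub_sub_cancel_left, norm_neg, norm_normalized_smul ha hs]
  have h1 := norm_sq_simProj_sub_fixed_le hne hcl hcv hw0 hw1 y hz
  have h2 := norm_simProj_sub_le hne hcl hcv hw0 hw1 y x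
  have h3 : ‖simProj C w x - x‖ ≤
      ‖simProj C w y - y‖ + (‖simProj C w y - simProj C w x‖ + ‖y - x‖) := by
    calc ‖simProj C w x - x‖ =
          ‖(simProj C w y - y) - ((simProj C w y - simProj C w x) - (y - x))‖ := by
          congr 1
          abel
      _ ≤ _ := (_root_.norm_sub_le _ _).trans (by gcongr; exact _root_.norm_sub_le _ _)
  have h4 : ‖y - z‖ ≤ ‖x - z‖ + a := by
    calc ‖y - z‖ = ‖(x - z) + (y - x)‖ := by congr 1; abel
      _ ≤ _ := (norm_add_le _ _).trans (by gcongr)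
  have h5 : ‖y - z‖ ^ 2 ≤ (‖x - z‖ + a) ^ 2 := pow_le_pow_left₀ (norm_nonneg _) h4 2
  have h6 : (η / 2) ^ 2 ≤ ‖simProj C w y - y‖ ^ 2 :=
    pow_le_pow_left₀ (by linarith) (by linarith) 2
  nlinarith [mul_le_mul_of_nonneg_right hM ha]

/-- Outside the `δ`-neighbourhood of `SOL`, steps of small size decrease the squared distance to
`SOL` in proportion to the step size. -/
theorem descent {S D : Set H} {f : H → ℝ} (hS : Convex ℝ S) (hSc : IsCompact S)
    (hCS : ∀ i, C i ⊆ S) (hSD : S ⊆ D) (hf : ContinuousOn f D)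
    (hint : SOL f (Function.fixedPoints (simProj C w)) ⊆ interior D)
    (hsol : (SOL f (Function.fixedPoints (simProj C w))).Nonempty) {δ : ℝ} (hδ : 0 < δ) :
    ∃ r > 0, ∃ a₀ > 0, ∀ a x x', 0 ≤ a → a ≤ a₀ → x ∈ S → IsStep D f C w a x x' →
      δ ≤ Metric.infDist x (SOL f (Function.fixedPoints (simProj C w))) →
      Metric.infDist x' (SOL f (Function.fixedPoints (simProj C w))) ^ 2 ≤
        Metric.infDist x (SOL f (Function.fixedPoints (simProj C w))) ^ 2 - r * a := by
  have hFc := isCompact_fixedPoints hne hcl hcv hw0 hw1 hS hSc hCS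
  have hFS : Function.fixedPoints (simProj C w) ⊆ S := fun x hx => by
    rw [← show simProj C w x = x from hx]
    exact simProj_mem hne hcl hcv hw0 hw1 hS hCS x
  have hKc := isCompact_SOL hFc (hf.mono (hFS.trans hSD))
  obtain ⟨z₀, hz₀⟩ := hsol
  obtain ⟨ε, hε, hgap⟩ := exists_gap hne hcl hcv hSc (hf.mono hSD) hz₀ hδ
  obtain ⟨r, hr, hball⟩ := exists_radius_SOL hf hKc hint hε
  obtain ⟨M, hM⟩ := hSc.isBounded.exists_norm_le
  have hM0 : 0 ≤ M := (norm_nonneg _).trans (hM z₀ (hFS hz₀.1))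
  -- The last bound makes the gain `ε ^ 2 / 4` of `P_w` outweigh `(4 * M + 1 + r) * a`.
  refine ⟨r, hr, min (min r 1) (min (ε / 4) (ε ^ 2 / (4 * (4 * M + 1 + r)))), by positivity,
    fun a x x' ha ha₀ hx hstep hd => ?_⟩
  obtain ⟨ha1, ha2⟩ := le_min_iff.1 ha₀
  obtain ⟨har, ha1⟩ := le_min_iff.1 ha1
  obtain ⟨haε, haM⟩ := le_min_iff.1 ha2
  obtain ⟨z, hz, e⟩ := hKc.exists_infDist_eq_dist ⟨z₀, hz₀⟩ x
  have h1 : Metric.infDist x' (SOL f (Function.fixedPoints (simProj C w))) ≤ ‖x' - z‖ := by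
    rw [← dist_eq_norm]
    exact Metric.infDist_le_dist_of_mem hz
  refine (pow_le_pow_left₀ Metric.infDist_nonneg h1 2).trans ?_
  rw [e, dist_eq_norm]
  rcases hgap x hx hd with hval | hmove
  · refine hstep.norm_sq_sub_le_of_ball hne hcl hcv hw0 hw1 ha hr.le har hz.1 fun y hy => ?_
    have h2 := hball z hz y hy
    rw [eq_of_mem_SOL hz hz₀] at h2
    exact ⟨h2.1, h2.2.trans_le hval⟩
  · have hxz : ‖x - z‖ ≤ 2 * M := by
      refine (_root_.norm_sub_le _ _).trans ?_
      linarith [hM x hx, hM z (hFS hz.1)]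
    have h2 := hstep.norm_sq_sub_le_of_move hne hcl hcv hw0 hw1 ha (by linarith) hz.1 hxz hmove
    rw [le_div_iff₀ (by positivity)] at haM
    nlinarith

end Step

/-! ### Sequences of distances -/

/-- A bounded sequence `d` that falls by a multiple of `α` in the square while it is at least `δ`
ends up below `2 * δ`, from an index on that does not depend on `d`. -/
theorem exists_forall_le_of_descent {α : ℕ → ℝ} (hα0 : ∀ k, 0 ≤ α k)
    (hα : Filter.Tendsto α Filter.atTop (nhds 0))
    (hsum : Filter.Tendsto (fun n => ∑ k ∈ Finset.range n, α k) Filter.atTop Filter.atTop)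
    {δ r a₀ : ℝ} (M : ℝ) (hδ : 0 < δ) (hr : 0 < r) (ha₀ : 0 < a₀) :
    ∃ K : ℕ, ∀ d : ℕ → ℝ, (∀ k, 0 ≤ d k) → (∀ k, d k ≤ M) → (∀ k, d (k + 1) ≤ d k + α k) →
      (∀ k, α k ≤ a₀ → δ ≤ d k → d (k + 1) ^ 2 ≤ d k ^ 2 - r * α k) →
      ∀ k ≥ K, d k ≤ 2 * δ := by
  obtain ⟨N, hN⟩ := Filter.eventually_atTop.1
    (hα.eventually_le_const (show 0 < min a₀ δ by positivity))
  obtain ⟨K, hK, hNK⟩ := ((hsum.eventually_gt_atTop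
    (∑ k ∈ Finset.range N, α k + M ^ 2 / r)).and (Filter.eventually_ge_atTop N)).exists
  refine ⟨K, fun d hd0 hdM hstep hdesc => ?_⟩
  have hstay : ∀ k ≥ N, d k ≤ 2 * δ → d (k + 1) ≤ 2 * δ := fun k hk h => by
    obtain ⟨h1, h2⟩ := le_min_iff.1 (hN k hk)
    rcases le_or_gt δ (d k) with h3 | h3
    · have h4 := hdesc k h1 h3
      have h5 : 0 ≤ r * α k := mul_nonneg hr.le (hα0 k)
      exact (abs_le_of_sq_le_sq' (by linarith) (hd0 k)).2.trans h
    · linarith [hstep k]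
  have henter : ∃ k, N ≤ k ∧ k ≤ K ∧ d k ≤ 2 * δ := by
    by_contra! hfar
    have htel : ∀ n, N ≤ n → n ≤ K →
        d n ^ 2 + r * (∑ k ∈ Finset.range n, α k - ∑ k ∈ Finset.range N, α k) ≤ d N ^ 2 := by
      intro n hn
      induction n, hn using Nat.le_induction with
      | base => simp
      | succ n hn ih =>
        intro hnK
        have h1 := ih (by omega)
        have h2 := hdesc n (le_min_iff.1 (hN n hn)).1 (by linarith [hfar n hn (by omega)])
        rw [Finset.sum_range_succ]
        linarith
    have h1 := htel K hNK le_rfl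
    have h2 : d N ^ 2 ≤ M ^ 2 := pow_le_pow_left₀ (hd0 N) (hdM N) 2
    have h3 : M ^ 2 / r < ∑ k ∈ Finset.range K, α k - ∑ k ∈ Finset.range N, α k := by linarith
    rw [div_lt_iff₀ hr] at h3
    nlinarith [sq_nonneg (d K)]
  obtain ⟨k₀, hNk₀, hk₀K, hk₀⟩ := henter
  intro k hk
  have hall : ∀ n, k₀ ≤ n → d n ≤ 2 * δ := fun n hn => by
    induction n, hn using Nat.le_induction with
    | base => exact hk₀
    | succ n hn ih => exact hstay n (hNk₀.trans hn) ih
  exact hall k (hk₀K.trans hk)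

end HSPSM

theorem theorem7p2 {H : Type*} [NormedAddCommGroup H] [InnerProductSpace ℝ H] [CompleteSpace H]
    {m : ℕ} (C : Fin m → Set H) (w : Fin m → ℝ) (S D : Set H) (f : H → ℝ)
    -- the constraints data, whose intersection may be empty
    (hC_nonempty : ∀ i, (C i).Nonempty) (hC_closed : ∀ i, IsClosed (C i))
    (hC_convex : ∀ i, Convex ℝ (C i))
    (hw_nonneg : ∀ i, 0 ≤ w i) (hw_sum : ∑ i, w i = 1)
    -- the compact convex set
    (hS_convex : Convex ℝ S) (hS_compact : IsCompact S)
    (hCS : ∀ i, C i ⊆ S) (hPS : ∀ x ∈ S, HSPSM.simProj C w x ∈ S)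
    -- the target function, with domain `D` (the choice `D = S` is allowed)
    (hSD : S ⊆ D) (hf_convex : ConvexOn ℝ D f) (hf_cont : ContinuousOn f D)
    (h_int : HSPSM.SOL f (Function.fixedPoints (HSPSM.simProj C w)) ⊆ interior D) :
    Function.fixedPoints (HSPSM.simProj C w) =
        {x | ∀ y, HSPSM.prox C w x ≤ HSPSM.prox C w y} ∧
    (HSPSM.SOL f (Function.fixedPoints (HSPSM.simProj C w))).Nonempty ∧
    ∃ L : ℝ, 1 < L ∧
      ∀ α : ℕ → ℝ, (∀ k, α k ∈ Set.Ioc (0 : ℝ) 1) →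
        Filter.Tendsto α Filter.atTop (nhds 0) →
        Filter.Tendsto (fun n => ∑ k ∈ Finset.range n, α k) Filter.atTop Filter.atTop →
      ∀ τ ∈ Set.Ioo (0 : ℝ) 1, ∃ K : ℕ,
        ∀ x : ℕ → H, (∀ k, x k ∈ S) → HSPSM.IsGenerated D f C w α x →
        ∀ k ≥ K,
          Metric.infDist (x k) (HSPSM.SOL f (Function.fixedPoints (HSPSM.simProj C w))) ≤ τ ∧
          ∀ z ∈ HSPSM.SOL f (Function.fixedPoints (HSPSM.simProj C w)),
            f (x k) ≤ f z + τ * L := by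
  have hFc := HSPSM.isCompact_fixedPoints hC_nonempty hC_closed hC_convex hw_nonneg hw_sum hS_convex
    hS_compact hCS
  have hFS : Function.fixedPoints (HSPSM.simProj C w) ⊆ S := fun x hx => by
    rw [← show HSPSM.simProj C w x = x from hx]
    exact HSPSM.simProj_mem hC_nonempty hC_closed hC_convex hw_nonneg hw_sum hS_convex hCS x
  have hfF := hf_cont.mono (hFS.trans hSD)
  have hsol := HSPSM.SOL_nonempty hFc (HSPSM.fixedPoints_nonempty hC_nonempty hC_closed hC_convex
    hw_nonneg hw_sum hS_convex hS_compact hCS) hfF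
  have hKc := HSPSM.isCompact_SOL hFc hfF
  refine ⟨HSPSM.fixedPoints_eq_argmin_prox hC_nonempty hC_closed hC_convex hw_nonneg hw_sum,
    hsol, ?_⟩
  obtain ⟨r, hr, hball⟩ := HSPSM.exists_radius_SOL hf_cont hKc h_int one_pos
  refine ⟨1 / r + 1, by linarith [one_div_pos.2 hr], fun α hα hα0 hsum τ hτ => ?_⟩
  have hτ0 : 0 < τ := hτ.1
  -- The estimate for `f` is available only within distance `r` of the solutions.
  have hσ : 0 < min τ r := lt_min hτ0 hr
  obtain ⟨ρ, hρ, a₀, ha₀, hdesc⟩ := HSPSM.descent hC_nonempty hC_closed hC_convex hw_nonneg hw_sum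
    hS_convex hS_compact hCS hSD hf_cont h_int hsol (half_pos hσ)
  obtain ⟨M, hM⟩ := hS_compact.isBounded.exists_norm_le
  obtain ⟨K, hK⟩ := HSPSM.exists_forall_le_of_descent (fun k => (hα k).1.le) hα0 hsum (2 * M)
    (half_pos hσ) hρ ha₀
  refine ⟨K, fun x hxS hgen k hk => ?_⟩
  have hd : Metric.infDist (x k) (HSPSM.SOL f (Function.fixedPoints (HSPSM.simProj C w))) ≤
      2 * (min τ r / 2) := by
    refine hK (fun k => Metric.infDist (x k)
      (HSPSM.SOL f (Function.fixedPoints (HSPSM.simProj C w))))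
      (fun _ => Metric.infDist_nonneg) (fun n => ?_) (fun n => ?_)
      (fun n hn hfar => hdesc _ _ _ (hα n).1.le hn (hxS n) (hgen.isStep n) hfar) k hk
    · obtain ⟨z, hz⟩ := hsol
      refine (Metric.infDist_le_dist_of_mem hz).trans ?_
      rw [dist_eq_norm]
      refine (norm_sub_le _ _).trans ?_
      linarith [hM _ (hxS n), hM z (hFS hz.1)]
    · obtain ⟨z, hz, e⟩ := hKc.exists_infDist_eq_dist hsol (x n)
      refine (Metric.infDist_le_dist_of_mem hz).trans ?_
      rw [e, dist_eq_norm, dist_eq_norm]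
      exact (hgen.isStep n).norm_sub_le hC_nonempty hC_closed hC_convex hw_nonneg hw_sum
        (hα n).1.le hz.1
  rw [mul_div_cancel₀ _ (two_ne_zero' ℝ)] at hd
  have hdτ := hd.trans (min_le_left _ _)
  refine ⟨hdτ, fun z hz => ?_⟩
  have h1 := HSPSM.le_add_infDist_div hf_convex hKc hr hball hz (hd.trans (min_le_right _ _))
  have h2 := div_le_div_of_nonneg_right hdτ hr.le
  rw [mul_add, mul_one_div]
  linarith
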